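/- Let $(W,S)$ be a Coxeter system ($S$ finite or infinite) with Coxeter matrix $(m_{s,t})_{s,t\in S}$, $m_{s,t}\in\mathbb{N}\cup\{\infty\}$. Let $V$ be the real vector space with basis $\{\alpha_s : s\in S\}$, let $B$ be the symmetric bilinear form on $V$ with $B(\alpha_s,\alpha_t)=-\cos(\pi/m_{s,t})$ (equal to $-1$ if $m_{s,t}=\infty$), and let $W$ act linearly on $V$ by $s(v)=v-2B(\alpha_s,v)\,\alpha_s$ for $s \in S$. Let $\Phi=\{w(\alpha_s) : w\in W,\ s\in S\}$, let $\Phi^+$ be the set of those elements of $\Phi$ that are nonnegative linear combinations of the $\alpha_s$, let $\Phi^-=-\Phi^+$, and for $w\in W$ let $\Phi(w)=\Phi^+\cap w^{-1}(\Phi^-)$. For a reduced expression $\mathbf{x}=(s_1,\dots,s_n)$ of $w\in W$ put $\theta_k=s_n s_{n-1}\cdots s_{k+1}(\alpha_{s_k})$ for $1\le k\le n$; then $\theta_1,\dots,\theta_n$ are the distinct elements of $\Phi(w)$. The standard encoding of $\mathbf{x}$ is the function $T_{\mathbf{x}}:\Phi^+\to\mathbb{N}_0$ with $T_{\mathbf{x}}(\theta_k)=k$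 for $1\le k\le n$ and $T_{\mathbf{x}}(\lambda)=0$ for $\lambda\notin\Phi(w)$. Let $T:\Phi^+\to\mathbb{N}_0$ be any function and let $\operatorname{supp}(T)=\{\lambda\in\Phi^+ : T(\lambda)\neq 0\}$. Call $T$ sequential if $\operatorname{supp}(T)$ is finite and $T(\operatorname{supp}(T))=\{1,\dots,|\operatorname{supp}(T)|\}$. Call $T$ standard if for all $\alpha,\beta,\gamma\in\Phi^+$ with $\alpha\neq\beta$ and $\gamma=a\alpha+b\beta$ for some real $a,b\ge 0$, either $T(\alpha)\le T(\gamma)\le T(\beta)$ or $T(\alpha)\ge T(\gamma)\ge T(\beta)$. Then $T=T_{\mathbf{x}}$ for some reduced expression $\mathbf{x}$ of some $w\in W$ if and only if $T$ is sequential and standard. -/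

import Mathlib

/-! ### The geometric representation of a Coxeter system -/

section Auxiliary

open Polynomial.Chebyshev

/-- Two reflections `r₁ : z ↦ z - f z • x` and `r₂ : z ↦ z - g z • y` whose mutual pairings are
`f y = g x = -2 cos (π / m)` satisfy `(r₁ r₂) ^ m = 1`. -/
theorem reflection_mul_reflection_pow_eq_one {V : Type*} [AddCommGroup V] [Module ℝ V]
    {x y : V} {f g : Module.Dual ℝ V} (hf : f x = 2) (hg : g y = 2) (m : ℕ) (hm : 2 ≤ m)
    (hfy : f y = -2 * Real.cos (Real.pi / m)) (hgx : g x = -2 * Real.cos (Real.pi / m)) :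
    (Module.reflection hf * Module.reflection hg) ^ m = 1 := by
  ext z
  rw [Module.reflection_mul_reflection_pow_apply hf hg m z]
  have hm0 : (m : ℝ) ≠ 0 := by positivity
  obtain rfl | hm3 := eq_or_lt_of_le hm
  · have h0 : Real.cos (Real.pi / (2 : ℕ)) = 0 := by simp
    rw [h0] at hfy hgx
    simp [hfy, hgx]
    module
  · set θ : ℝ := 2 * (Real.pi / m) with hθ
    have ht : f y * g x - 2 = 2 * Real.cos θ := by
      rw [hfy, hgx, hθ, Real.cos_two_mul]; ring
    rw [ht]
    have hsin : Real.sin θ ≠ 0 := by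
      apply ne_of_gt
      apply Real.sin_pos_of_pos_of_lt_pi
      · have := Real.pi_pos
        positivity
      · rw [hθ, ← mul_div_assoc, div_lt_iff₀ (by positivity)]
        have : (3 : ℝ) ≤ m := by exact_mod_cast hm3
        nlinarith [Real.pi_pos]
    have hS (k : ℤ) : (S ℝ k).eval (2 * Real.cos θ) = Real.sin ((k + 1) * θ) / Real.sin θ := by
      rw [eq_div_iff hsin, S_two_mul_real_cos]
    obtain ⟨k, rfl | rfl⟩ := Nat.even_or_odd' m
    · -- both coefficients contain the factor `sin (k θ) = sin π = 0`
      have h1 : (((2 * k : ℕ) : ℤ) - 2) / 2 = (k : ℤ) - 1 := by lia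
      have h2 : (((2 * k : ℕ) : ℤ) - 1) / 2 = (k : ℤ) - 1 := by lia
      have hz : (S ℝ ((k : ℤ) - 1)).eval (2 * Real.cos θ) = 0 := by
        have : (((k : ℤ) - 1 : ℤ) + 1 : ℝ) * θ = Real.pi := by
          have hk : (k : ℝ) ≠ 0 := by
            have : k ≠ 0 := by lia
            exact_mod_cast this
          rw [hθ]; push_cast; field_simp; ring
        rw [hS, this]; simp
      rw [h1, h2, hz]; simp
    · -- both coefficients contain the factor `sin ((k + 1) θ) + sin (k θ) = 0`
      have h1 : (((2 * k + 1 : ℕ) : ℤ) - 2) / 2 = (k : ℤ) - 1 := by lia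
      have h2 : (((2 * k + 1 : ℕ) : ℤ) - 1) / 2 = (k : ℤ) := by lia
      have h3 : (((2 * k + 1 : ℕ) : ℤ) - 3) / 2 = (k : ℤ) - 1 := by lia
      have h4 : (((2 * k + 1 : ℕ) : ℤ)) / 2 = (k : ℤ) := by lia
      have hz : (S ℝ (k : ℤ)).eval (2 * Real.cos θ) + (S ℝ ((k : ℤ) - 1)).eval (2 * Real.cos θ)
          = 0 := by
        have e : (((k : ℤ) : ℝ) + 1) * θ = 2 * Real.pi - (((k : ℤ) - 1 : ℤ) + 1 : ℝ) * θ := by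
          rw [hθ]; push_cast at hm0 ⊢; field_simp; ring
        rw [hS, hS, e, Real.sin_two_pi_sub]; ring
      rw [h1, h2, h3, h4, hz]; simp

end Auxiliary

namespace CoxeterMatrix

/-- The simple root `α_i`: the `i`-th standard basis vector of the real vector space `B →₀ ℝ`
with basis `{α_i : i ∈ B}`. -/
noncomputable def simpleRoot {B : Type*} (_M : CoxeterMatrix B) (i : B) : B →₀ ℝ :=
  Finsupp.single i 1

/-- The number `-cos (π / m_{ij})`, read as `-1` if `m_{ij} = ∞` (which Mathlib encodes as
`M i j = 0`). -/
noncomputable def formCoeff {B : Type*} (M : CoxeterMatrix B) (i j : B) : ℝ :=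
  if M i j = 0 then -1 else -Real.cos (Real.pi / M i j)

/-- The symmetric bilinear form on `B →₀ ℝ` with value `-cos (π / m_{ij})` at `(α_i, α_j)`. -/
noncomputable def geomForm {B : Type*} (M : CoxeterMatrix B) :
    LinearMap.BilinForm ℝ (B →₀ ℝ) :=
  Finsupp.linearCombination ℝ fun i => Finsupp.linearCombination ℝ fun j => M.formCoeff i j

theorem geomForm_simpleRoot {B : Type*} (M : CoxeterMatrix B) (i j : B) :
    M.geomForm (M.simpleRoot i) (M.simpleRoot j) = M.formCoeff i j := by
  simp [geomForm, simpleRoot]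

theorem formCoeff_self {B : Type*} (M : CoxeterMatrix B) (i : B) : M.formCoeff i i = 1 := by
  simp [formCoeff]

theorem two_smul_geomForm_simpleRoot_self {B : Type*} (M : CoxeterMatrix B) (i : B) :
    ((2 : ℝ) • M.geomForm (M.simpleRoot i)) (M.simpleRoot i) = 2 := by
  simp [geomForm_simpleRoot, formCoeff_self]

/-- The reflection `v ↦ v - 2 B(α_i, v) α_i`. -/
noncomputable def simpleReflection {B : Type*} (M : CoxeterMatrix B) (i : B) :
    (B →₀ ℝ) ≃ₗ[ℝ] (B →₀ ℝ) :=
  Module.reflection (M.two_smul_geomForm_simpleRoot_self i)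

theorem simpleReflection_apply {B : Type*} (M : CoxeterMatrix B) (i : B) (v : B →₀ ℝ) :
    M.simpleReflection i v = v - (2 * M.geomForm (M.simpleRoot i) v) • M.simpleRoot i := by
  simp [simpleReflection, Module.reflection_apply]

theorem isLiftable_simpleReflection {B : Type*} (M : CoxeterMatrix B) :
    M.IsLiftable M.simpleReflection := by
  intro i j
  by_cases hij : i = j
  · subst hij
    rw [M.diagonal, pow_one]
    ext1 v
    exact Module.involutive_reflection (M.two_smul_geomForm_simpleRoot_self i) v
  · by_cases h0 : M i j = 0
    · rw [h0, pow_zero]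
    · have h1 := M.off_diagonal i j hij
      refine reflection_mul_reflection_pow_eq_one _ _ _ (by lia) ?_ ?_
      · simp [geomForm_simpleRoot, formCoeff, h0]
      · rw [M.symmetric i j] at h0 ⊢
        simp [geomForm_simpleRoot, formCoeff, h0]

end CoxeterMatrix

namespace CoxeterSystem

/-- The geometric representation of a Coxeter system: the simple reflection `s_i` acts by
`v ↦ v - 2 B(α_i, v) α_i`. -/
noncomputable def geomRep {B W : Type*} [Group W] {M : CoxeterMatrix B}
    (cs : CoxeterSystem M W) : W →* ((B →₀ ℝ) ≃ₗ[ℝ] (B →₀ ℝ)) :=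
  cs.lift ⟨M.simpleReflection, M.isLiftable_simpleReflection⟩

theorem geomRep_simple {B W : Type*} [Group W] {M : CoxeterMatrix B}
    (cs : CoxeterSystem M W) (i : B) : cs.geomRep (cs.simple i) = M.simpleReflection i :=
  cs.lift_apply_simple M.isLiftable_simpleReflection i

/-- The root system `Φ = {w(α_i) : w ∈ W, i ∈ B}`. -/
def rootSet {B W : Type*} [Group W] {M : CoxeterMatrix B} (cs : CoxeterSystem M W) :
    Set (B →₀ ℝ) :=
  {v | ∃ (w : W) (i : B), v = cs.geomRep w (M.simpleRoot i)}

/-- The positive system `Φ⁺`: the roots that are nonnegative linear combinations of the simple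
roots, that is, whose coordinates in the basis of simple roots are all nonnegative. -/
def posRoots {B W : Type*} [Group W] {M : CoxeterMatrix B} (cs : CoxeterSystem M W) :
    Set (B →₀ ℝ) :=
  {v | v ∈ cs.rootSet ∧ ∀ i, 0 ≤ v i}

/-- The negative system `Φ⁻ = -Φ⁺`. -/
def negRoots {B W : Type*} [Group W] {M : CoxeterMatrix B} (cs : CoxeterSystem M W) :
    Set (B →₀ ℝ) :=
  {v | -v ∈ cs.posRoots}

/-- The inversion set `Φ(w) = Φ⁺ ∩ w⁻¹(Φ⁻)`: the positive roots that `w` sends to negative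
roots. -/
def invSet {B W : Type*} [Group W] {M : CoxeterMatrix B} (cs : CoxeterSystem M W) (w : W) :
    Set (B →₀ ℝ) :=
  {v | v ∈ cs.posRoots ∧ cs.geomRep w v ∈ cs.negRoots}

/-- The root sequence `(θ_1, …, θ_n)` of a word `(s_1, …, s_n)`, where
`θ_k = s_n ⋯ s_{k+1} (α_{s_k})`. -/
noncomputable def rootSeq {B W : Type*} [Group W] {M : CoxeterMatrix B}
    (cs : CoxeterSystem M W) : List B → List (B →₀ ℝ)
  | [] => []
  | i :: ω => cs.geomRep (cs.wordProd ω.reverse) (M.simpleRoot i) :: rootSeq cs ω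

open Classical in
/-- The standard encoding `T_x : Φ⁺ → ℕ` of a reduced expression `x = (s_1, …, s_n)` of `w`:
`T_x(λ) = 0` for `λ ∉ Φ(w)`, and `T_x(θ_k) = k` for the roots `θ_1, …, θ_n` of the root sequence,
which are the distinct elements of `Φ(w)`. -/
noncomputable def stdEncoding {B W : Type*} [Group W] {M : CoxeterMatrix B}
    (cs : CoxeterSystem M W) (ω : List B) : cs.posRoots → ℕ := fun v =>
  if (v : B →₀ ℝ) ∈ cs.invSet (cs.wordProd ω) then (cs.rootSeq ω).idxOf (v : B →₀ ℝ) + 1 else 0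

end CoxeterSystem

/-! ### Labelings -/

/-- A labeling is sequential if its support is finite and its values on the support are exactly
`1, …, |supp T|`. -/
def IsSequentialLabeling {X : Type*} (T : X → ℕ) : Prop :=
  (Function.support T).Finite ∧
    T '' Function.support T = Set.Icc 1 (Function.support T).ncard

/-- The convex cone `{a α + b β : a, b ≥ 0}` spanned by two vectors. -/
def convexConeOfPair {V : Type*} [AddCommGroup V] [Module ℝ V] (α β : V) : Set V :=
  {v | ∃ a b : ℝ, 0 ≤ a ∧ 0 ≤ b ∧ v = a • α + b • β}

/-- A labeling of the positive roots is standard if, for all distinct positive roots `α`, `β` and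
every positive root `γ` in the convex cone spanned by `α` and `β`, the label of `γ` lies weakly
between the labels of `α` and `β`. -/
def CoxeterSystem.IsStandardLabeling {B W : Type*} [Group W] {M : CoxeterMatrix B}
    (cs : CoxeterSystem M W) (T : cs.posRoots → ℕ) : Prop :=
  ∀ α β γ : cs.posRoots, α ≠ β →
    (γ : B →₀ ℝ) ∈ convexConeOfPair (α : B →₀ ℝ) (β : B →₀ ℝ) →
      (T α ≤ T γ ∧ T γ ≤ T β) ∨ (T β ≤ T γ ∧ T γ ≤ T α)

/-! ### Images of simple roots under alternating words -/

namespace CoxeterMatrix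

variable {B : Type*} (M : CoxeterMatrix B)

/-! Everything rests on each root being positive or negative (`geomRep_simpleRoot_nonneg`). Given
this, the superlevel sets of a standard encoding are the inversion sets of suffixes of the word.
Inversion sets and their complements in `Φ⁺` are closed under taking positive roots in cones, so
labels lie between. Conversely, induct on the largest label. Lowering all nonzero labels by one
keeps `T` standard, so the result encodes a reduced word `ω` of some `w`, and it remains to see that
the root `θ` labelled 1 has the form `w⁻¹ α_i`; then `i :: ω` is the word sought. If `w θ` were not
simple, it would be a positive root plus a positive multiple of a simple root, and pulling this
relation back by `w⁻¹` violates standardness or positivity of `θ` (`exists_geomRep_eq_simpleRoot`).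
-/

theorem simpleReflection_simpleRoot (i j : B) :
    M.simpleReflection i (M.simpleRoot j) =
      M.simpleRoot j + (-2 * M.formCoeff i j) • M.simpleRoot i := by
  rw [simpleReflection_apply, geomForm_simpleRoot]
  module

theorem simpleReflection_simpleRoot_self (i : B) :
    M.simpleReflection i (M.simpleRoot i) = -M.simpleRoot i := by
  rw [simpleReflection_simpleRoot, formCoeff_self]
  module

theorem simpleRoot_nonneg (i : B) : 0 ≤ M.simpleRoot i :=
  Finsupp.single_nonneg.2 zero_le_one

theorem formCoeff_comm (i j : B) : M.formCoeff i j = M.formCoeff j i := by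
  simp [formCoeff, M.symmetric i j]

theorem geomForm_comm (x y : B →₀ ℝ) : M.geomForm x y = M.geomForm y x := by
  have h : M.geomForm = M.geomForm.flip := by
    ext i j
    simpa [simpleRoot] using (M.geomForm_simpleRoot i j).trans
      ((M.formCoeff_comm i j).trans (M.geomForm_simpleRoot j i).symm)
  exact congrArg (fun f => f x y) h

theorem geomForm_simpleReflection (i : B) (x y : B →₀ ℝ) :
    M.geomForm (M.simpleReflection i x) (M.simpleReflection i y) = M.geomForm x y := by
  have h1 : M.geomForm (M.simpleRoot i) (M.simpleRoot i) = 1 := by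
    rw [geomForm_simpleRoot, formCoeff_self]
  simp only [simpleReflection_apply, map_sub, map_smul, LinearMap.sub_apply, LinearMap.smul_apply,
    smul_eq_mul, h1, M.geomForm_comm x (M.simpleRoot i)]
  ring

/-- The coefficients of the images of a simple root under alternating words in `s_i` and `s_j`. -/
noncomputable def alternatingCoeff (i j : B) : ℕ → ℝ
  | 0 => 0
  | 1 => 1
  | k + 2 => -2 * M.formCoeff i j * alternatingCoeff i j (k + 1) - alternatingCoeff i j k

theorem alternatingCoeff_of_eq_zero {i j : B} (h : M i j = 0) (k : ℕ) :
    M.alternatingCoeff i j k = k := by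
  induction k using Nat.twoStepInduction with
  | zero => simp [alternatingCoeff]
  | one => simp [alternatingCoeff]
  | more k h1 h2 =>
    rw [alternatingCoeff, h1, h2, formCoeff, if_pos h]
    push_cast
    ring

/-- The recursion is that of `sin (k t)` with `t = π / m`, so the coefficients are `sin (k t) / sin
t`; they are nonnegative for `k ≤ m`. -/
theorem alternatingCoeff_mul_sin {i j : B} (h : M i j ≠ 0) (k : ℕ) :
    M.alternatingCoeff i j k * Real.sin (Real.pi / M i j) = Real.sin (k * (Real.pi / M i j)) := by
  induction k using Nat.twoStepInduction with
  | zero => simp [alternatingCoeff]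
  | one => simp [alternatingCoeff]
  | more k h1 h2 =>
    rw [alternatingCoeff, sub_mul, h1, mul_assoc, h2, formCoeff, if_neg h]
    push_cast
    set t := Real.pi / M i j
    have e : (k : ℝ) * t = (k + 1) * t - t := by ring
    have e' : ((k : ℝ) + 2) * t = (k + 1) * t + t := by ring
    rw [e, e', Real.sin_add, Real.sin_sub]
    ring

theorem alternatingCoeff_nonneg {i j : B} (hij : i ≠ j) {k : ℕ} (hk : M i j ≠ 0 → k ≤ M i j) :
    0 ≤ M.alternatingCoeff i j k := by
  by_cases h : M i j = 0
  · simp [M.alternatingCoeff_of_eq_zero h]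
  · have h2 : (2 : ℝ) ≤ M i j := by
      have := M.off_diagonal i j hij
      exact_mod_cast (by lia : 2 ≤ M i j)
    have hk' : (k : ℝ) ≤ M i j := by exact_mod_cast hk h
    have hs : 0 < Real.sin (Real.pi / M i j) := by
      refine Real.sin_pos_of_pos_of_lt_pi (by have := Real.pi_pos; positivity) ?_
      rw [div_lt_iff₀ (by linarith)]
      nlinarith [Real.pi_pos]
    refine nonneg_of_mul_nonneg_left ?_ hs
    rw [M.alternatingCoeff_mul_sin h]
    refine Real.sin_nonneg_of_nonneg_of_le_pi (by have := Real.pi_pos; positivity) ?_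
    rw [← mul_div_assoc, div_le_iff₀ (by linarith)]
    nlinarith [Real.pi_pos]

end CoxeterMatrix

namespace CoxeterSystem

open CoxeterMatrix

variable {B W : Type*} [Group W] {M : CoxeterMatrix B} (cs : CoxeterSystem M W)

theorem geomRep_mul_apply (w u : W) (v : B →₀ ℝ) :
    cs.geomRep (w * u) v = cs.geomRep w (cs.geomRep u v) := by
  rw [map_mul]; rfl

theorem geomRep_inv_apply_self (w : W) (v : B →₀ ℝ) :
    cs.geomRep w⁻¹ (cs.geomRep w v) = v := by
  rw [← geomRep_mul_apply]; simp

theorem geomRep_apply_inv_self (w : W) (v : B →₀ ℝ) :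
    cs.geomRep w (cs.geomRep w⁻¹ v) = v := by
  rw [← geomRep_mul_apply]; simp

theorem geomRep_eq_iff {w : W} {x y : B →₀ ℝ} :
    cs.geomRep w x = y ↔ x = cs.geomRep w⁻¹ y := by
  constructor
  · rintro rfl
    rw [geomRep_inv_apply_self]
  · rintro rfl
    rw [geomRep_apply_inv_self]

theorem geomRep_alternatingWord (i j : B) (k : ℕ) :
    cs.geomRep (cs.wordProd (alternatingWord i j k)) (M.simpleRoot i) =
      M.alternatingCoeff i j (k + 1) • M.simpleRoot (if Even k then i else j) +
        M.alternatingCoeff i j k • M.simpleRoot (if Even k then j else i) := by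
  induction k with
  | zero => simp [alternatingWord, alternatingCoeff]
  | succ k ih =>
    rw [alternatingWord_succ', wordProd_cons, geomRep_mul_apply, ih, geomRep_simple, map_add,
      map_smul, map_smul, simpleReflection_simpleRoot_self, simpleReflection_simpleRoot]
    by_cases hk : Even k
    · simp only [hk, if_true, Nat.even_add_one, not_true_eq_false, if_false, alternatingCoeff,
        M.formCoeff_comm j i]
      module
    · simp only [hk, if_true, Nat.even_add_one, not_false_eq_true, if_false, alternatingCoeff]
      module

/-! ### Positivity of roots -/

/-- `w` has a reduced expression that ends with the word `ω`. -/
def HasReducedSuffix (w : W) (ω : List B) : Prop :=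
  ∃ v, w = v * cs.wordProd ω ∧ cs.length w = cs.length v + ω.length

theorem HasReducedSuffix.tail {cs : CoxeterSystem M W} {w : W} {i : B} {ω : List B}
    (h : cs.HasReducedSuffix w (i :: ω)) : cs.HasReducedSuffix w ω := by
  obtain ⟨v, rfl, hl⟩ := h
  refine ⟨v * cs.simple i, by rw [wordProd_cons, mul_assoc], ?_⟩
  have h1 := cs.length_mul_le v (cs.simple i)
  have h2 := cs.length_mul_le (v * cs.simple i) (cs.wordProd ω)
  have h3 := cs.length_wordProd_le ω
  rw [length_simple] at h1
  rw [mul_assoc, ← wordProd_cons] at h2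
  simp only [List.length_cons] at hl
  lia

theorem HasReducedSuffix.alternatingWord_of_le {cs : CoxeterSystem M W} {w : W} {i j : B}
    {k l : ℕ} (hkl : k ≤ l) (h : cs.HasReducedSuffix w (alternatingWord i j l)) :
    cs.HasReducedSuffix w (alternatingWord i j k) := by
  induction l, hkl using Nat.le_induction with
  | base => exact h
  | succ l _ ih =>
    rw [alternatingWord_succ'] at h
    exact ih h.tail

/-- `alternatingWord i j k` ends in `j`. Once its length reaches `m`, the braid relation gives a
reduced expression of `w` ending in `i`, making `i` a right descent. -/
theorem not_hasReducedSuffix_alternatingWord {w : W} {i j : B} (h0 : M i j ≠ 0)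
    (hi : ¬cs.IsRightDescent w i) {k : ℕ} (hk : M i j ≤ k) :
    ¬cs.HasReducedSuffix w (alternatingWord i j k) := by
  intro h
  obtain ⟨v, hv, hl⟩ := h.alternatingWord_of_le hk
  apply hi
  have hb : cs.wordProd (alternatingWord i j (M i j)) =
      cs.wordProd (alternatingWord j i (M i j)) := by
    have := cs.wordProd_braidWord_eq i j
    rwa [braidWord, braidWord, M.symmetric j i] at this
  obtain ⟨m, hm⟩ := Nat.exists_eq_succ_of_ne_zero h0
  rw [hb, hm, Nat.succ_eq_add_one, alternatingWord_succ, wordProd_concat, ← mul_assoc] at hv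
  rw [length_alternatingWord, hm] at hl
  have h1 := cs.length_mul_le v (cs.wordProd (alternatingWord i j m))
  have h2 := cs.length_wordProd_le (alternatingWord i j m)
  rw [length_alternatingWord] at h2
  rw [IsRightDescent, hl, hv, simple_mul_simple_cancel_right]
  lia

/-- Split off from `w` its longest alternating suffix in `i`, `j`, where `j` is a right descent. The
suffix sends `α_i` to a nonnegative combination of `α_i` and `α_j`, and the shorter remaining factor
`v` has neither letter as a right descent, so induction on length applies to both terms. -/
theorem geomRep_simpleRoot_nonneg {w : W} {i : B} (hi : ¬cs.IsRightDescent w i) :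
    0 ≤ cs.geomRep w (M.simpleRoot i) := by
  classical
  induction hn : cs.length w using Nat.strong_induction_on generalizing w i with
  | _ n ih =>
  by_cases hw : w = 1
  · subst hw
    simpa using M.simpleRoot_nonneg i
  obtain ⟨j, hj⟩ := cs.exists_rightDescent_of_ne_one hw
  have hij : i ≠ j := by
    rintro rfl
    exact hi hj
  have h1 : cs.HasReducedSuffix w (alternatingWord i j 1) := by
    refine ⟨w * cs.simple j, by simp [alternatingWord], ?_⟩
    simpa [alternatingWord] using (cs.isRightDescent_iff.1 hj).symm
  have hbound (k : ℕ) (h : cs.HasReducedSuffix w (alternatingWord i j k)) :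
      k ≤ cs.length w := by
    obtain ⟨v, -, hl⟩ := h
    rw [length_alternatingWord] at hl
    lia
  obtain ⟨k, hk1, hk, hmax⟩ : ∃ k, 1 ≤ k ∧ cs.HasReducedSuffix w (alternatingWord i j k) ∧
      ¬cs.HasReducedSuffix w (alternatingWord i j (k + 1)) := by
    refine ⟨Nat.findGreatest (fun k => cs.HasReducedSuffix w (alternatingWord i j k))
      (cs.length w), Nat.le_findGreatest (hbound 1 h1) h1,
      Nat.findGreatest_spec (P := fun k => cs.HasReducedSuffix w (alternatingWord i j k))
        (hbound 1 h1) h1, fun h => ?_⟩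
    have := Nat.le_findGreatest (P := fun k => cs.HasReducedSuffix w (alternatingWord i j k))
      (hbound _ h) h
    lia
  have hkm : M i j ≠ 0 → k + 1 ≤ M i j := fun h0 => by
    by_contra! hlt
    exact cs.not_hasReducedSuffix_alternatingWord h0 hi (by lia) hk
  obtain ⟨v, hv, hl⟩ := hk
  rw [length_alternatingWord] at hl
  -- A descent at the letter that would extend the suffix contradicts maximality.
  have hc : ¬cs.IsRightDescent v (if Even k then j else i) := by
    intro hd
    apply hmax
    rw [alternatingWord_succ']
    refine ⟨v * cs.simple (if Even k then j else i), ?_, ?_⟩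
    · rw [wordProd_cons, ← mul_assoc, simple_mul_simple_cancel_right, hv]
    · have := cs.isRightDescent_iff.1 hd
      rw [List.length_cons, length_alternatingWord]
      lia
  -- The other letter is the first letter of the suffix, and lengths add up in the factorization of
  -- `w`.
  have hd : ¬cs.IsRightDescent v (if Even k then i else j) := by
    obtain ⟨l, rfl⟩ := Nat.exists_eq_add_of_le' hk1
    rw [alternatingWord_succ', wordProd_cons, ← mul_assoc] at hv
    have h2 := cs.length_mul_le (v * cs.simple (if Even l then j else i))
      (cs.wordProd (alternatingWord i j l))
    have h3 := cs.length_wordProd_le (alternatingWord i j l)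
    rw [length_alternatingWord] at h3
    rw [← hv] at h2
    have e : (if Even (l + 1) then i else j) = if Even l then j else i := by
      by_cases hl : Even l <;> simp [hl, Nat.even_add_one]
    rw [e, IsRightDescent]
    lia
  rw [hv, geomRep_mul_apply, geomRep_alternatingWord, map_add, map_smul, map_smul]
  exact add_nonneg
    (smul_nonneg (M.alternatingCoeff_nonneg hij hkm) (ih _ (by lia) hd rfl))
    (smul_nonneg (M.alternatingCoeff_nonneg hij fun h => by have := hkm h; lia)
      (ih _ (by lia) hc rfl))

theorem geomRep_simpleRoot_nonpos {w : W} {i : B} (hi : cs.IsRightDescent w i) :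
    cs.geomRep w (M.simpleRoot i) ≤ 0 := by
  have h := cs.geomRep_simpleRoot_nonneg (cs.isRightDescent_iff_not_isRightDescent_mul.1 hi)
  rw [geomRep_mul_apply, geomRep_simple, simpleReflection_simpleRoot_self, map_neg] at h
  exact neg_nonneg.1 h

/-! ### Decomposition of the root system into positive and negative roots. -/

theorem simpleRoot_mem_rootSet (i : B) : M.simpleRoot i ∈ cs.rootSet := ⟨1, i, by simp⟩

theorem geomRep_mem_rootSet (w : W) {v : B →₀ ℝ} (hv : v ∈ cs.rootSet) :
    cs.geomRep w v ∈ cs.rootSet := by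
  obtain ⟨u, i, rfl⟩ := hv
  exact ⟨w * u, i, by rw [geomRep_mul_apply]⟩

theorem neg_mem_rootSet {v : B →₀ ℝ} (hv : v ∈ cs.rootSet) : -v ∈ cs.rootSet := by
  obtain ⟨u, i, rfl⟩ := hv
  exact ⟨u * cs.simple i, i, by
    rw [geomRep_mul_apply, geomRep_simple, simpleReflection_simpleRoot_self, map_neg]⟩

theorem simpleRoot_mem_posRoots (i : B) : M.simpleRoot i ∈ cs.posRoots :=
  ⟨cs.simpleRoot_mem_rootSet i, M.simpleRoot_nonneg i⟩

theorem mem_posRoots_or_neg_mem {v : B →₀ ℝ} (hv : v ∈ cs.rootSet) :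
    v ∈ cs.posRoots ∨ -v ∈ cs.posRoots := by
  obtain ⟨w, i, rfl⟩ := id hv
  by_cases hi : cs.IsRightDescent w i
  · exact .inr ⟨cs.neg_mem_rootSet hv, neg_nonneg.2 (cs.geomRep_simpleRoot_nonpos hi)⟩
  · exact .inl ⟨hv, cs.geomRep_simpleRoot_nonneg hi⟩

theorem geomForm_geomRep (w : W) (x y : B →₀ ℝ) :
    M.geomForm (cs.geomRep w x) (cs.geomRep w y) = M.geomForm x y := by
  induction w using cs.simple_induction_left with
  | one => simp
  | mul_simple_left w i ih =>
    rw [geomRep_mul_apply, geomRep_mul_apply, geomRep_simple, geomForm_simpleReflection, ih]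

theorem geomForm_self_of_mem_rootSet {v : B →₀ ℝ} (hv : v ∈ cs.rootSet) :
    M.geomForm v v = 1 := by
  obtain ⟨w, i, rfl⟩ := hv
  rw [geomForm_geomRep, geomForm_simpleRoot, formCoeff_self]

theorem ne_zero_of_mem_rootSet {v : B →₀ ℝ} (hv : v ∈ cs.rootSet) : v ≠ 0 := by
  rintro rfl
  simpa using cs.geomForm_self_of_mem_rootSet hv

theorem neg_notMem_posRoots {v : B →₀ ℝ} (hv : v ∈ cs.posRoots) : -v ∉ cs.posRoots := fun h =>
  cs.ne_zero_of_mem_rootSet hv.1 (le_antisymm (neg_nonneg.1 h.2) hv.2)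

theorem neg_mem_posRoots_iff {v : B →₀ ℝ} (hv : v ∈ cs.rootSet) :
    -v ∈ cs.posRoots ↔ v ∉ cs.posRoots :=
  ⟨fun h h' => cs.neg_notMem_posRoots h' h, (cs.mem_posRoots_or_neg_mem hv).resolve_left⟩

/-- A simple reflection permutes the positive roots other than its own simple root. -/
theorem simpleReflection_mem_posRoots {v : B →₀ ℝ} (hv : v ∈ cs.posRoots) {i : B}
    (hi : v ≠ M.simpleRoot i) : M.simpleReflection i v ∈ cs.posRoots := by
  have hr : M.simpleReflection i v ∈ cs.rootSet := by
    rw [← cs.geomRep_simple]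
    exact cs.geomRep_mem_rootSet _ hv.1
  refine (cs.mem_posRoots_or_neg_mem hr).resolve_right fun hneg => hi ?_
  -- The reflection changes only coordinate `i`, so a negative image forces `v` to be a multiple of
  -- `α_i`; its norm then makes it `α_i`.
  have hz (j : B) (hj : j ≠ i) : v j = 0 := by
    have h := hneg.2 j
    rw [simpleReflection_apply] at h
    simp only [Finsupp.neg_apply, Finsupp.sub_apply, Finsupp.smul_apply, simpleRoot,
      Finsupp.single_eq_of_ne hj, smul_zero, sub_zero] at h
    exact le_antisymm (neg_nonneg.1 h) (hv.2 j)
  have he : v = v i • M.simpleRoot i := by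
    ext j
    by_cases hj : j = i
    · subst hj; simp [simpleRoot]
    · simp [simpleRoot, hz j hj, Finsupp.single_eq_of_ne hj]
  have h1 := cs.geomForm_self_of_mem_rootSet hv.1
  rw [he, map_smul, map_smul, LinearMap.smul_apply, geomForm_simpleRoot, formCoeff_self,
    smul_eq_mul, smul_eq_mul, mul_one] at h1
  have h2 : v i = 1 := by nlinarith [hv.2 i]
  rw [he, h2, one_smul]

/-- A positive root that is not simple lies in the interior of the cone spanned by a positive root
and a simple root. -/
theorem exists_eq_add_smul_simpleRoot {v : B →₀ ℝ} (hv : v ∈ cs.posRoots)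
    (hns : ∀ i, v ≠ M.simpleRoot i) :
    ∃ u ∈ cs.posRoots, ∃ i, ∃ c : ℝ, 0 < c ∧ u ≠ M.simpleRoot i ∧
      v = u + c • M.simpleRoot i := by
  -- Otherwise `B(v, v) = ∑ v_i B(α_i, v) ≤ 0`, whereas roots have norm 1. For such `i` the
  -- decomposition is `v = s_i v + 2 B(α_i, v) α_i`.
  obtain ⟨i, hi⟩ : ∃ i, 0 < M.geomForm (M.simpleRoot i) v := by
    by_contra! h
    have h1 := cs.geomForm_self_of_mem_rootSet hv.1
    have h2 : M.geomForm v v = v.sum fun i a => a * M.geomForm (M.simpleRoot i) v := by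
      conv_lhs => rw [M.geomForm_comm]; enter [2]; rw [← v.sum_single]
      rw [map_finsuppSum]
      refine Finsupp.sum_congr fun i _ => ?_
      rw [M.geomForm_comm, ← smul_eq_mul, ← LinearMap.smul_apply, ← map_smul, simpleRoot,
        Finsupp.smul_single, smul_eq_mul, mul_one]
    have h3 : M.geomForm v v ≤ 0 := by
      rw [h2]
      exact Finset.sum_nonpos fun i _ => mul_nonpos_of_nonneg_of_nonpos (hv.2 i) (h i)
    linarith
  refine ⟨M.simpleReflection i v, cs.simpleReflection_mem_posRoots hv (hns i), i,
    2 * M.geomForm (M.simpleRoot i) v, by positivity, fun h => ?_, ?_⟩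
  · have h' : v = M.simpleReflection i (M.simpleRoot i) := by
      rw [← h, simpleReflection, Module.involutive_reflection]
    rw [simpleReflection_simpleRoot_self] at h'
    exact cs.neg_notMem_posRoots hv (by rw [h', neg_neg]; exact cs.simpleRoot_mem_posRoots i)
  · rw [simpleReflection_apply, sub_add_cancel]

/-! ### Inversion sets and root sequences -/

theorem mem_invSet_iff {w : W} {v : B →₀ ℝ} (hv : v ∈ cs.posRoots) :
    v ∈ cs.invSet w ↔ cs.geomRep w v ∉ cs.posRoots := by
  rw [← cs.neg_mem_posRoots_iff (cs.geomRep_mem_rootSet w hv.1)]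
  exact and_iff_right hv

theorem notMem_invSet_one (v : B →₀ ℝ) : v ∉ cs.invSet 1 := fun h =>
  (cs.mem_invSet_iff h.1).1 h (by simpa using h.1)

theorem mem_posRoots_inv_iff {w : W} {i : B} :
    cs.geomRep w⁻¹ (M.simpleRoot i) ∈ cs.posRoots ↔ ¬cs.IsLeftDescent w i := by
  have hr := cs.geomRep_mem_rootSet w⁻¹ (cs.simpleRoot_mem_rootSet i)
  rw [← isRightDescent_inv_iff]
  refine ⟨fun h hi => ?_, fun h => ⟨hr, cs.geomRep_simpleRoot_nonneg h⟩⟩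
  exact cs.neg_notMem_posRoots h
    ⟨cs.neg_mem_rootSet hr, neg_nonneg.2 (cs.geomRep_simpleRoot_nonpos hi)⟩

/-- As `s_i` permutes the positive roots other than `α_i`, passing from `w` to `s_i w` can alter the
sign of the image only for `±w⁻¹ α_i`, and the plus sign gives the positive one since `i` is not a
left descent. -/
theorem mem_invSet_simple_mul {w : W} {i : B} (hi : ¬cs.IsLeftDescent w i) {v : B →₀ ℝ} :
    v ∈ cs.invSet (cs.simple i * w) ↔
      v = cs.geomRep w⁻¹ (M.simpleRoot i) ∨ v ∈ cs.invSet w := by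
  by_cases hv : v ∈ cs.posRoots
  swap
  · have h1 : v ≠ cs.geomRep w⁻¹ (M.simpleRoot i) := by
      rintro rfl
      exact hv (cs.mem_posRoots_inv_iff.2 hi)
    exact iff_of_false (fun h => hv h.1) (by rintro (h | h); exacts [h1 h, hv h.1])
  rw [mem_invSet_iff cs hv, mem_invSet_iff cs hv, geomRep_mul_apply, geomRep_simple,
    ← geomRep_eq_iff]
  by_cases he : cs.geomRep w v = M.simpleRoot i
  · rw [he, simpleReflection_simpleRoot_self]
    simpa using cs.neg_notMem_posRoots (cs.simpleRoot_mem_posRoots i)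
  simp only [he, false_or, not_iff_not]
  refine ⟨fun h => ?_, fun h => cs.simpleReflection_mem_posRoots h he⟩
  have h2 : M.simpleReflection i (M.simpleReflection i (cs.geomRep w v)) = cs.geomRep w v := by
    rw [simpleReflection, Module.involutive_reflection]
  -- Here `w v = -α_i`, so `w⁻¹ α_i = -v` would be negative.
  by_cases h3 : M.simpleReflection i (cs.geomRep w v) = M.simpleRoot i
  · exfalso
    rw [h3, simpleReflection_simpleRoot_self, eq_comm, geomRep_eq_iff, map_neg] at h2
    exact cs.neg_notMem_posRoots (cs.mem_posRoots_inv_iff.2 hi) (h2 ▸ hv)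
  · rw [← h2]
    exact cs.simpleReflection_mem_posRoots h h3

theorem isReduced_cons_iff {i : B} {ω : List B} :
    cs.IsReduced (i :: ω) ↔ cs.IsReduced ω ∧ ¬cs.IsLeftDescent (cs.wordProd ω) i := by
  have h := cs.length_wordProd_le ω
  have h2 := cs.length_simple_mul (cs.wordProd ω) i
  simp only [IsReduced, IsLeftDescent, wordProd_cons, List.length_cons]
  lia

theorem rootSeq_cons (i : B) (ω : List B) :
    cs.rootSeq (i :: ω) =
      cs.geomRep (cs.wordProd ω)⁻¹ (M.simpleRoot i) :: cs.rootSeq ω := by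
  rw [rootSeq, wordProd_reverse]

theorem length_rootSeq (ω : List B) : (cs.rootSeq ω).length = ω.length := by
  induction ω with
  | nil => rfl
  | cons i ω ih => rw [rootSeq_cons, List.length_cons, List.length_cons, ih]

theorem mem_rootSeq_iff {ω : List B} (hω : cs.IsReduced ω) {v : B →₀ ℝ} :
    v ∈ cs.rootSeq ω ↔ v ∈ cs.invSet (cs.wordProd ω) := by
  induction ω with
  | nil => simpa [rootSeq] using cs.notMem_invSet_one v
  | cons i ω ih =>
    obtain ⟨hω, hi⟩ := cs.isReduced_cons_iff.1 hω
    rw [rootSeq_cons, wordProd_cons, List.mem_cons, ih hω, mem_invSet_simple_mul cs hi]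

theorem notMem_invSet_inv_simpleRoot (w : W) (i : B) :
    cs.geomRep w⁻¹ (M.simpleRoot i) ∉ cs.invSet w := fun h =>
  (cs.mem_invSet_iff h.1).1 h
    (by rw [geomRep_apply_inv_self]; exact cs.simpleRoot_mem_posRoots i)

theorem nodup_rootSeq {ω : List B} (hω : cs.IsReduced ω) : (cs.rootSeq ω).Nodup := by
  induction ω with
  | nil => exact List.nodup_nil
  | cons i ω ih =>
    obtain ⟨hω, -⟩ := cs.isReduced_cons_iff.1 hω
    rw [rootSeq_cons, List.nodup_cons, mem_rootSeq_iff cs hω]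
    exact ⟨cs.notMem_invSet_inv_simpleRoot _ i, ih hω⟩

/-! ### Standard encodings -/

theorem stdEncoding_ne_zero_iff {ω : List B} {v : cs.posRoots} :
    cs.stdEncoding ω v ≠ 0 ↔ (v : B →₀ ℝ) ∈ cs.invSet (cs.wordProd ω) := by
  unfold stdEncoding
  split_ifs with h <;> simp [h]

-- Since labels count positions from the left, prepending a letter raises the old nonzero labels by
-- one and gives label 1 to the new root. Both directions of the theorem recurse on this.
open Classical in
theorem stdEncoding_cons {i : B} {ω : List B} (hω : cs.IsReduced (i :: ω)) (v : cs.posRoots) :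
    cs.stdEncoding (i :: ω) v =
      if (v : B →₀ ℝ) = cs.geomRep (cs.wordProd ω)⁻¹ (M.simpleRoot i) then 1
      else if cs.stdEncoding ω v = 0 then 0 else cs.stdEncoding ω v + 1 := by
  obtain ⟨-, hi⟩ := cs.isReduced_cons_iff.1 hω
  have h := cs.mem_invSet_simple_mul hi (v := v)
  rw [← wordProd_cons] at h
  by_cases h1 : (v : B →₀ ℝ) = cs.geomRep (cs.wordProd ω)⁻¹ (M.simpleRoot i)
  · rw [if_pos h1, stdEncoding, if_pos (h.2 (.inl h1)), rootSeq_cons, h1, List.idxOf_cons_self]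
  · rw [if_neg h1]
    by_cases h2 : (v : B →₀ ℝ) ∈ cs.invSet (cs.wordProd ω)
    · rw [if_neg (cs.stdEncoding_ne_zero_iff.2 h2), stdEncoding, if_pos (h.2 (.inr h2)),
        stdEncoding, if_pos h2, rootSeq_cons, List.idxOf_cons_ne _ (Ne.symm h1)]
    · rw [if_pos (by_contra fun h3 => h2 (cs.stdEncoding_ne_zero_iff.1 h3)), stdEncoding,
        if_neg (by rw [h]; tauto)]

/-- The superlevel sets of the standard encoding of a reduced expression are inversion sets. -/
theorem exists_lt_stdEncoding_iff {ω : List B} (hω : cs.IsReduced ω) (k : ℕ) :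
    ∃ u, ∀ v : cs.posRoots, k < cs.stdEncoding ω v ↔ (v : B →₀ ℝ) ∈ cs.invSet u := by
  classical
  induction ω generalizing k with
  | nil =>
    refine ⟨1, fun v => iff_of_false ?_ (cs.notMem_invSet_one _)⟩
    simp [stdEncoding, cs.notMem_invSet_one]
  | cons i ω ih =>
    cases k with
    | zero =>
      exact ⟨cs.wordProd (i :: ω), fun v => by
        rw [← stdEncoding_ne_zero_iff, Nat.pos_iff_ne_zero]⟩
    | succ k =>
      have hω' := (cs.isReduced_cons_iff.1 hω).1
      -- The label shift identifies level `k + 1` for `i :: ω` with level `k` for `ω`; the new root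
      -- has label 1 and lies in neither set.
      obtain ⟨u, hu⟩ := ih hω' k
      refine ⟨u, fun v => ?_⟩
      rw [← hu, stdEncoding_cons cs hω]
      split_ifs with h1 h2
      · have h3 : cs.stdEncoding ω v = 0 := by_contra fun h3 =>
          cs.notMem_invSet_inv_simpleRoot _ i (h1 ▸ cs.stdEncoding_ne_zero_iff.1 h3)
        lia
      · lia
      · lia

/-- Linearity of the action makes inversion sets closed and coclosed in cones; applied to all
superlevel sets, this bounds the label of `γ` below by the minimum and above by the maximum of the
other two. -/
theorem isStandardLabeling_stdEncoding {ω : List B} (hω : cs.IsReduced ω) :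
    cs.IsStandardLabeling (cs.stdEncoding ω) := by
  rintro α β γ - ⟨a, b, ha, hb, hγ⟩
  have himg (u : W) : cs.geomRep u γ = a • cs.geomRep u α + b • cs.geomRep u β := by
    rw [hγ, map_add, map_smul, map_smul]
  have hmin (k : ℕ) (h1 : k < cs.stdEncoding ω α) (h2 : k < cs.stdEncoding ω β) :
      k < cs.stdEncoding ω γ := by
    obtain ⟨u, hu⟩ := cs.exists_lt_stdEncoding_iff hω k
    rw [hu] at h1 h2 ⊢
    refine ⟨γ.2, cs.neg_mem_rootSet (cs.geomRep_mem_rootSet u γ.2.1), ?_⟩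
    change 0 ≤ -cs.geomRep u γ
    have h3 : -cs.geomRep u γ = a • -cs.geomRep u α + b • -cs.geomRep u β := by
      rw [himg]; module
    rw [h3]
    exact add_nonneg (smul_nonneg ha h1.2.2) (smul_nonneg hb h2.2.2)
  have hmax (k : ℕ) (h1 : ¬k < cs.stdEncoding ω α) (h2 : ¬k < cs.stdEncoding ω β) :
      ¬k < cs.stdEncoding ω γ := by
    obtain ⟨u, hu⟩ := cs.exists_lt_stdEncoding_iff hω k
    rw [hu, mem_invSet_iff cs (Subtype.prop _), not_not] at h1 h2 ⊢
    refine ⟨cs.geomRep_mem_rootSet u γ.2.1, ?_⟩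
    change 0 ≤ cs.geomRep u γ
    rw [himg]
    exact add_nonneg (smul_nonneg ha h1.2) (smul_nonneg hb h2.2)
  have h1 := hmin (cs.stdEncoding ω γ)
  have h2 := hmax (max (cs.stdEncoding ω α) (cs.stdEncoding ω β))
  lia

theorem isSequentialLabeling_stdEncoding {ω : List B} (hω : cs.IsReduced ω) :
    IsSequentialLabeling (cs.stdEncoding ω) := by
  classical
  have hsupp : Subtype.val '' Function.support (cs.stdEncoding ω) =
      ((cs.rootSeq ω).toFinset : Set (B →₀ ℝ)) := by
    ext v
    simp only [Set.mem_image, Function.mem_support, stdEncoding_ne_zero_iff, Subtype.exists,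
      exists_and_right, exists_eq_right, List.coe_toFinset, Set.mem_ofPred_eq,
      cs.mem_rootSeq_iff hω]
    exact ⟨fun h => h.2, fun h => ⟨h.1, h⟩⟩
  have hcard : (Function.support (cs.stdEncoding ω)).ncard = ω.length := by
    rw [← Set.ncard_image_of_injective _ Subtype.val_injective, hsupp, Set.ncard_coe_finset,
      List.toFinset_card_of_nodup (cs.nodup_rootSeq hω), length_rootSeq]
  refine ⟨Set.Finite.of_finite_image (hsupp ▸ Finset.finite_toSet _)
    Subtype.val_injective.injOn, ?_⟩
  rw [hcard]
  ext k
  constructor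
  · rintro ⟨v, hv, rfl⟩
    have hv' := cs.stdEncoding_ne_zero_iff.1 hv
    refine ⟨Nat.one_le_iff_ne_zero.2 hv, ?_⟩
    rw [stdEncoding, if_pos hv', ← length_rootSeq cs ω, Nat.add_one_le_iff]
    exact List.idxOf_lt_length_of_mem ((cs.mem_rootSeq_iff hω).2 hv')
  · rintro ⟨h1, h2⟩
    obtain ⟨k, rfl⟩ := Nat.exists_eq_add_of_le' h1
    have hk : k < (cs.rootSeq ω).length := by rw [length_rootSeq]; lia
    have hm := (cs.mem_rootSeq_iff hω).1 (List.getElem_mem hk)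
    refine ⟨⟨_, hm.1⟩, cs.stdEncoding_ne_zero_iff.2 hm, ?_⟩
    rw [stdEncoding, if_pos hm, (cs.nodup_rootSeq hω).idxOf_getElem]

/-! ### Recovering a reduced word from a standard labeling. -/

/-- If both `Φ(w)` and `Φ(w) ∪ {θ}` are cut out by a standard labeling, then `w` sends `θ` to a
simple root. -/
theorem exists_geomRep_eq_simpleRoot {T : cs.posRoots → ℕ} (hT : cs.IsStandardLabeling T) {w : W}
    {θ : cs.posRoots} (hw : ∀ v : cs.posRoots, (v : B →₀ ℝ) ∈ cs.invSet w ↔ 1 < T v)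
    (hθ : ∀ v : cs.posRoots, T v = 1 ↔ v = θ) :
    ∃ i, cs.geomRep w θ = M.simpleRoot i := by
  by_contra! hns
  have hT1 : T θ = 1 := (hθ θ).2 rfl
  have hwθ : cs.geomRep w θ ∈ cs.posRoots := by
    have := (cs.mem_invSet_iff θ.2).not.1 (by rw [hw]; lia)
    exact not_not.1 this
  obtain ⟨u, hu, i, c, hc, hui, he⟩ := cs.exists_eq_add_smul_simpleRoot hwθ hns
  set v := M.simpleRoot i
  have hv : v ∈ cs.posRoots := cs.simpleRoot_mem_posRoots i
  have hθe : (θ : B →₀ ℝ) = cs.geomRep w⁻¹ u + c • cs.geomRep w⁻¹ v := by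
    rw [cs.geomRep_eq_iff.1 he, map_add, map_smul]
  -- preimages of positive roots are either negative, or positive outside of `Φ(w)`
  have hpre {x : B →₀ ℝ} (hx : x ∈ cs.posRoots) (h : cs.geomRep w⁻¹ x ∈ cs.posRoots)
      (hne : x ≠ cs.geomRep w θ) : T ⟨_, h⟩ = 0 := by
    have h1 : ¬1 < T ⟨_, h⟩ := by
      rw [← hw, mem_invSet_iff cs h, geomRep_apply_inv_self]
      exact not_not.2 hx
    have h2 : T ⟨_, h⟩ ≠ 1 := by
      rw [Ne, hθ, Subtype.ext_iff]
      exact fun h => hne (by rw [← h, geomRep_apply_inv_self])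
    lia
  have hneg {x : B →₀ ℝ} (hx : x ∈ cs.posRoots) (h : -cs.geomRep w⁻¹ x ∈ cs.posRoots) :
      1 < T ⟨_, h⟩ := by
    rw [← hw, mem_invSet_iff cs h, map_neg, geomRep_apply_inv_self]
    exact cs.neg_notMem_posRoots hx
  have hune : u ≠ cs.geomRep w θ := by
    intro h
    rw [← h, left_eq_add] at he
    exact (smul_ne_zero hc.ne' (cs.ne_zero_of_mem_rootSet hv.1)) he
  have hvne : v ≠ cs.geomRep w θ := (hns i).symm
  have hru := cs.geomRep_mem_rootSet w⁻¹ hu.1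
  have hrv := cs.geomRep_mem_rootSet w⁻¹ hv.1
  -- Signs of `w⁻¹ u` and `w⁻¹ v`, with `θ = w⁻¹ u + c w⁻¹ v`. If both are positive, `θ` has label 1
  -- between two zeros. If the signs differ, the positive one lies in the cone of `θ` and the
  -- negated other one, so 0 lies between 1 and a label above 1. If both are negative, so is `θ`.
  rcases cs.mem_posRoots_or_neg_mem hru with pu | pu <;>
    rcases cs.mem_posRoots_or_neg_mem hrv with pv | pv
  · have h1 := hpre hu pu hune
    have h2 := hpre hv pv hvne
    have h3 := hT ⟨_, pu⟩ ⟨_, pv⟩ θ (fun h => hui ?_)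
      ⟨1, c, zero_le_one, hc.le, by rw [hθe, one_smul]⟩
    · lia
    · exact (cs.geomRep w⁻¹).injective (Subtype.ext_iff.1 h)
  · have h1 := hpre hu pu hune
    have h2 := hneg hv pv
    have h3 := hT θ ⟨_, pv⟩ ⟨_, pu⟩ (fun h => ?_)
      ⟨1, c, zero_le_one, hc.le, by rw [hθe]; module⟩
    · lia
    · rw [← h] at h2; lia
  · have h1 := hpre hv pv hvne
    have h2 := hneg hu pu
    have h3 := hT θ ⟨_, pu⟩ ⟨_, pv⟩ (fun h => ?_)
      ⟨c⁻¹, c⁻¹, by positivity, by positivity, by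
        rw [hθe, ← smul_add, add_neg_cancel_comm, smul_smul, inv_mul_cancel₀ hc.ne', one_smul]⟩
    · lia
    · rw [← h] at h2; lia
  · have h1 : 0 ≤ -(θ : B →₀ ℝ) := by
      have h2 : -(θ : B →₀ ℝ) = -cs.geomRep w⁻¹ u + c • -cs.geomRep w⁻¹ v := by
        rw [hθe]; module
      rw [h2]
      exact add_nonneg pu.2 (smul_nonneg hc.le pv.2)
    exact cs.neg_notMem_posRoots θ.2 ⟨cs.neg_mem_rootSet θ.2.1, h1⟩

theorem IsStandardLabeling.exists_eq_stdEncoding {cs : CoxeterSystem M W} {T : cs.posRoots → ℕ}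
    (hT : cs.IsStandardLabeling T) {n : ℕ} (himg : T '' Function.support T = Set.Icc 1 n)
    (hinj : Set.InjOn T (Function.support T)) :
    ∃ ω, cs.IsReduced ω ∧ T = cs.stdEncoding ω := by
  classical
  induction n generalizing T with
  | zero =>
    refine ⟨[], by simp [IsReduced], ?_⟩
    funext v
    have h : cs.stdEncoding [] v = 0 := by simp [stdEncoding, cs.notMem_invSet_one]
    rw [h]
    by_contra hv
    have := himg ▸ Set.mem_image_of_mem T (show v ∈ Function.support T from hv)
    simp at this
  | succ n ih =>
    -- Truncated subtraction is monotone, so it preserves betweenness; it merges label 1 with label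
    -- 0.
    have hT' : cs.IsStandardLabeling fun v => T v - 1 := fun α β γ hne hγ => by
      have := hT α β γ hne hγ
      lia
    have hle (v) : T v ≤ n + 1 := by
      by_cases hv : T v = 0
      · lia
      · exact (himg ▸ Set.mem_image_of_mem T (show v ∈ Function.support T from hv)).2
    have hex (k : ℕ) (h1 : 1 ≤ k) (h2 : k ≤ n + 1) : ∃ v, T v = k := by
      obtain ⟨v, -, hv⟩ := himg.symm ▸ (show k ∈ Set.Icc 1 (n + 1) from ⟨h1, h2⟩)
      exact ⟨v, hv⟩
    obtain ⟨ω, hω, hTω⟩ := ih hT'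
      (by
        ext k
        constructor
        · rintro ⟨v, hv, rfl⟩
          have := hle v
          have : T v - 1 ≠ 0 := hv
          simp only [Set.mem_Icc]
          lia
        · rintro ⟨h1, h2⟩
          obtain ⟨v, hv⟩ := hex (k + 1) (by lia) (by lia)
          exact ⟨v, show T v - 1 ≠ 0 by lia, show T v - 1 = k by lia⟩)
      (fun v hv u hu h => by
        have h1 : T v - 1 ≠ 0 := hv
        have h2 : T u - 1 ≠ 0 := hu
        have h3 : T v - 1 = T u - 1 := h
        exact hinj (show T v ≠ 0 by lia) (show T u ≠ 0 by lia) (by lia))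
    obtain ⟨θ, hθ⟩ := hex 1 le_rfl (by lia)
    have hθ' (v : cs.posRoots) : T v = 1 ↔ v = θ :=
      ⟨fun h => hinj (show T v ≠ 0 by lia) (show T θ ≠ 0 by lia) (h.trans hθ.symm),
        fun h => h ▸ hθ⟩
    have hw (v : cs.posRoots) : (v : B →₀ ℝ) ∈ cs.invSet (cs.wordProd ω) ↔ 1 < T v := by
      rw [← stdEncoding_ne_zero_iff, ← hTω]
      lia
    obtain ⟨i, hi⟩ := cs.exists_geomRep_eq_simpleRoot hT hw hθ'
    rw [geomRep_eq_iff] at hi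
    have hred : cs.IsReduced (i :: ω) :=
      cs.isReduced_cons_iff.2 ⟨hω, cs.mem_posRoots_inv_iff.1 (hi ▸ θ.2)⟩
    refine ⟨i :: ω, hred, ?_⟩
    funext v
    rw [stdEncoding_cons cs hred, ← hi, ← hTω]
    split_ifs with h1 h2
    · rw [Subtype.ext h1, hθ]
    · have := (hθ' v).not.2 fun h => h1 (congrArg _ h)
      lia
    · lia

end CoxeterSystem

theorem proposition4p1 {B W : Type*} [Group W] {M : CoxeterMatrix B} (cs : CoxeterSystem M W)
    (T : cs.posRoots → ℕ) :
    (∃ (w : W) (ω : List B), cs.wordProd ω = w ∧ cs.IsReduced ω ∧ T = cs.stdEncoding ω) ↔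
      (IsSequentialLabeling T ∧ cs.IsStandardLabeling T) := by
  constructor
  · rintro ⟨w, ω, -, hω, rfl⟩
    exact ⟨cs.isSequentialLabeling_stdEncoding hω, cs.isStandardLabeling_stdEncoding hω⟩
  · rintro ⟨⟨hfin, himg⟩, hT⟩
    -- A finite support with as many labels as elements makes `T` injective on it.
    obtain ⟨ω, hω, h⟩ := hT.exists_eq_stdEncoding himg
      (Set.injOn_of_ncard_image_eq (by rw [himg]; simp) hfin)
    exact ⟨_, ω, rfl, hω, h⟩
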